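/- Let $q \ge 4$ be a prime power, let $t \ge 0$ be an integer, and let $F$ be a finite field of order $q$. The doubled Grassmann graph $G = dJ_q(2t+1,t)$ is the graph whose vertices are the $t$-dimensional and the $(t+1)$-dimensional subspaces of $F^{2t+1}$, two distinct vertices being adjacent when one of the two subspaces is contained in the other. For a graph $G$ with vertex set $V$, and for $A, B \subseteq V$, let $E[A,B]$ be the number of ordered pairs $(x,y)$ of adjacent vertices with $x \in A$ and $y \in B$, let $\mathrm{vol}(S)$ be the sum of the valencies of the vertices in $S$, and let $$h_G = \inf\Big\{ \frac{E[S,S^c]}{\mathrm{vol}(S)} \;:\; \emptyset \ne S \subseteq V,\ |S| \le \frac{|V|}{2} \Big\}$$ be the Cheeger constant of $G$. Let $\lambda_1$ be the smallest positive eigenvalue of the (normalized) Laplacian matrix $T^{-1/2}(T-A)T^{-1/2}$, where $A$ is the adjacency matrix and $T$ the diagonal matrix of valencies (this is $I - \frac1k A$ if $G$ is regular of valency $k > 0$). Then, for $G = dJ_q(2t+1,t)$, the Laplacian matrix has a smallest positive eigenvalue $\lambda_1$, there is a nonempty set $S \subseteq V$ with $|S| \le |V|/2$ and $E[S,S^c]/\mathrm{vol}(S)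 \le \lambda_1$, and consequently $$h_G \le \lambda_1 .$$ -/

import Mathlib

namespace CheegerGraph

open scoped Classical in
/-- The number `E[A, B]` of ordered pairs `(x, y)` of adjacent vertices with `x ∈ A` and `y ∈ B`. -/
noncomputable def edgeCount {V : Type*} [Fintype V] (G : SimpleGraph V) (A B : Finset V) : ℕ :=
  (G.interedges A B).card

open scoped Classical in
/-- The volume `vol(S)`: the sum of the valencies of the vertices in `S`. -/
noncomputable def vol {V : Type*} [Fintype V] (G : SimpleGraph V) (S : Finset V) : ℕ :=
  ∑ x ∈ S, G.degree x

open scoped Classical in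
/-- The ratio `E[S, Sᶜ] / vol(S)`. -/
noncomputable def cheegerRatio {V : Type*} [Fintype V] (G : SimpleGraph V) (S : Finset V) : ℝ :=
  (edgeCount G S Sᶜ : ℝ) / (vol G S : ℝ)

/-- The sets over which the Cheeger constant is an infimum: nonempty, with `|S| ≤ |V| / 2`. -/
def Admissible {V : Type*} [Fintype V] (S : Finset V) : Prop :=
  S.Nonempty ∧ (S.card : ℝ) ≤ (Fintype.card V : ℝ) / 2

/-- The Cheeger constant `h_G`. -/
noncomputable def cheegerConstant {V : Type*} [Fintype V] (G : SimpleGraph V) : ℝ :=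
  sInf {r : ℝ | ∃ S : Finset V, Admissible S ∧ r = cheegerRatio G S}

open scoped Classical in
/-- The normalized Laplacian `T^{-1/2} (T - A) T^{-1/2}`, with `T` the diagonal matrix of the
valencies and `A` the adjacency matrix. For a regular graph of valency `k > 0` it is
`I - (1/k) A`; see `laplacian_eq_of_regular`. -/
noncomputable def laplacian {V : Type*} [Fintype V] (G : SimpleGraph V) : Matrix V V ℝ :=
  Matrix.of fun x y =>
    G.lapMatrix ℝ x y / (Real.sqrt (G.degree x : ℝ) * Real.sqrt (G.degree y : ℝ))

open scoped Classical in
theorem laplacian_eq_of_regular {V : Type*} [Fintype V] (G : SimpleGraph V) (k : ℕ) (hk : 0 < k)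
    (hG : ∀ x, G.degree x = k) :
    laplacian G = (1 : Matrix V V ℝ) - (1 / (k : ℝ)) • G.adjMatrix ℝ := by
  have hk' : (k : ℝ) ≠ 0 := by positivity
  ext x y
  simp only [laplacian, Matrix.of_apply, hG, Real.mul_self_sqrt (Nat.cast_nonneg k),
    SimpleGraph.lapMatrix, SimpleGraph.degMatrix, Matrix.sub_apply, Matrix.smul_apply,
    smul_eq_mul, Matrix.diagonal_apply, Matrix.one_apply]
  split_ifs
  · field_simp
  · field_simp
    ring

open scoped Classical in
/-- The set of positive eigenvalues of the normalized Laplacian matrix. -/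
def positiveLaplacianEigenvalues {V : Type*} [Fintype V] (G : SimpleGraph V) : Set ℝ :=
  {l : ℝ | 0 < l ∧ Module.End.HasEigenvalue (Matrix.toLin' (laplacian G)) l}

/-- `λ₁`: the smallest positive eigenvalue of the normalized Laplacian matrix. -/
noncomputable def lambdaOne {V : Type*} [Fintype V] (G : SimpleGraph V) : ℝ :=
  sInf (positiveLaplacianEigenvalues G)

/-- A graph is OK if some admissible set gives an upper bound for `h_G` which is at most `λ₁`. -/
def IsOK {V : Type*} [Fintype V] (G : SimpleGraph V) : Prop :=
  ∃ S : Finset V, Admissible S ∧ cheegerRatio G S ≤ lambdaOne G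

/-- The vertices of `dJ_q(2t+1, t)`: subspaces of `F^(2t+1)` of dimension `t` or `t + 1`. -/
abbrev DoubledGrassmannVertex (F : Type*) [Field F] (t : ℕ) : Type _ :=
  {W : Submodule F (Fin (2 * t + 1) → F) //
    Module.finrank F W = t ∨ Module.finrank F W = t + 1}

noncomputable instance instFintypeDoubledGrassmannVertex (F : Type*) [Field F] [Finite F] (t : ℕ) :
    Fintype (DoubledGrassmannVertex F t) :=
  Fintype.ofFinite _

/-- The doubled Grassmann graph `dJ_q(2t+1, t)`, with `q` the order of `F`: two vertices are adjacent
when they are distinct and one of the two subspaces is contained in the other. -/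
def doubledGrassmannGraph (F : Type*) [Field F] (t : ℕ) :
    SimpleGraph (DoubledGrassmannVertex F t) where
  Adj U W := U ≠ W ∧ (U.1 ≤ W.1 ∨ W.1 ≤ U.1)
  symm := ⟨fun _ _ h => ⟨h.1.symm, h.2.symm⟩⟩
  loopless := ⟨fun _ h => h.1 rfl⟩

end CheegerGraph

namespace CheegerGraph

/-! ### Subspaces above and below a given subspace. -/

section Counting

open Module

variable {K V : Type*} [Field K] [AddCommGroup V] [Module K V]

/-! Write [n] for `qNumber q n` and k = [t+1] for the valency. Two independent estimates meet at
(k+1)/(2k).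

Upper side: |V| = 2h is even, and a uniformly random h-set has expected ratio h/(2h-1), so some
h-set does at least as well (`exists_card_eq_edgeCount_le`). Since k+1 ≤ |V| = 2h, this is at most
(k+1)/(2k).

Lower side: an adjacency eigenvalue 0 < θ < k has an eigenvector with sum zero on layer t, and θ² ≤
q[t]². For q ≥ 4 this gives 2θ ≤ q[t] = k-1, so the Laplacian eigenvalue 1-θ/k is at least
(k+1)/(2k) (`two_mul_add_one_le_of_eigenvector`).

The bound on θ² comes from climbing the subspace lattice. Let U_i be the inclusion operator from
layer i to layer i+1. In dimension n, U_{i+1}ᵀU_{i+1} - U_iU_iᵀ is the scalar [n-i-1] - [i+1]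
(`sum_sq_up_sub_sum_sq_down`), and U_i and U_iᵀ obey the same bound on sum-zero functions
(`sum_sq_transpose_le`). Induction bounds ‖U_t f‖² by a sum of these scalars, which for n = 2t+1
equals q[t]². -/

theorem finrank_comap_mkQ [FiniteDimensional K V] (x : Submodule K V) (H : Submodule K (V ⧸ x)) :
    finrank K (H.comap x.mkQ) = finrank K H + finrank K x := by
  have h1 := (Submodule.quotientQuotientEquivQuotient x (H.comap x.mkQ)
    (Submodule.le_comap_mkQ x H)).finrank_eq
  rw [Submodule.map_comap_eq_self (by simp)] at h1
  have h2 := Submodule.finrank_quotient_add_finrank x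
  have h3 := Submodule.finrank_quotient_add_finrank H
  have h4 := Submodule.finrank_quotient_add_finrank (H.comap x.mkQ)
  omega

theorem card_submodule_finrank_one [Finite K] (n : ℕ) (hn : finrank K V = n) :
    Nat.card {H : Submodule K V // finrank K H = 1} = ∑ i ∈ Finset.range n, Nat.card K ^ i := by
  rw [← Projectivization.card_of_finrank K V hn, Nat.card_congr (Projectivization.equivSubmodule K V)]

variable (K V) in
/-- The subspaces of dimension `i`. -/
noncomputable def subspaces [Fintype (Submodule K V)] (i : ℕ) : Finset (Submodule K V) :=
  Finset.univ.filter fun W => finrank K W = i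

@[simp]
theorem mem_subspaces [Fintype (Submodule K V)] {i : ℕ} {W : Submodule K V} : W ∈ subspaces K V i ↔ finrank K W = i := by
  simp [subspaces]

open scoped Classical in
-- By the modular law, either dim(x ⊔ x') = i+2 and dim(x ⊓ x') = i, so that the join and the meet
-- are the only candidates, or the join is too large and the meet too small, and both counts vanish.
-- This makes the off-diagonal entries of U_{i+1}ᵀU_{i+1} and U_iU_iᵀ agree.
theorem card_common_covers [FiniteDimensional K V] [Fintype (Submodule K V)]
    {x x' : Submodule K V} {i : ℕ} (hx : finrank K x = i + 1)
    (hx' : finrank K x' = i + 1) (hne : x ≠ x') :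
    ((subspaces K V (i + 2)).filter fun y => x ≤ y ∧ x' ≤ y).card =
      ((subspaces K V i).filter fun z => z ≤ x ∧ z ≤ x').card := by
  have hmod := Submodule.finrank_sup_add_finrank_inf_eq x x'
  have hlt : i + 1 < finrank K ↥(x ⊔ x') := by
    rw [← hx]
    apply Submodule.finrank_lt_finrank_of_lt
    rw [left_lt_sup]
    intro h
    exact hne (Submodule.eq_of_le_of_finrank_eq h (by rw [hx, hx'])).symm
  by_cases h : finrank K ↥(x ⊔ x') = i + 2
  · have h1 : ((subspaces K V (i + 2)).filter fun y => x ≤ y ∧ x' ≤ y) = {x ⊔ x'} := by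
      ext y
      simp only [Finset.mem_filter, mem_subspaces, Finset.mem_singleton, ← sup_le_iff]
      refine ⟨fun hy => (Submodule.eq_of_le_of_finrank_eq hy.2 (by rw [h, hy.1])).symm, ?_⟩
      rintro rfl
      exact ⟨h, le_rfl⟩
    have h2 : ((subspaces K V i).filter fun z => z ≤ x ∧ z ≤ x') = {x ⊓ x'} := by
      ext z
      simp only [Finset.mem_filter, mem_subspaces, Finset.mem_singleton, ← le_inf_iff]
      refine ⟨fun hz => Submodule.eq_of_le_of_finrank_eq hz.2 (by omega), ?_⟩
      rintro rfl
      exact ⟨by omega, le_rfl⟩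
    rw [h1, h2, Finset.card_singleton, Finset.card_singleton]
  · rw [Finset.filter_false_of_mem, Finset.filter_false_of_mem]
    · intro z hz hzx
      have := Submodule.finrank_mono (le_inf hzx.1 hzx.2)
      rw [mem_subspaces.1 hz] at this
      omega
    · intro y hy hyx
      have := Submodule.finrank_mono (sup_le hyx.1 hyx.2)
      rw [mem_subspaces.1 hy] at this
      omega

variable [Finite K] [FiniteDimensional K V]

/-- Annihilators match hyperplanes with lines of the dual space. -/
theorem card_submodule_finrank_pred (n : ℕ) (hn : finrank K V = n + 1) :
    Nat.card {H : Submodule K V // finrank K H = n} =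
      ∑ i ∈ Finset.range (n + 1), Nat.card K ^ i := by
  rw [← card_submodule_finrank_one (K := K) (V := Dual K V) (n + 1)
    (by rw [Subspace.dual_finrank_eq, hn])]
  refine Nat.card_congr (Equiv.subtypeEquiv
    (Subspace.orderIsoFiniteDimensional (K := K) (V := V)).toEquiv fun H => ?_)
  have h := Subspace.finrank_add_finrank_dualAnnihilator_eq H
  change _ ↔ finrank K H.dualAnnihilator = 1
  omega

theorem card_covers (x : Submodule K V) (i m : ℕ) (hx : finrank K x = i)
    (hm : finrank K V = i + m) :
    Nat.card {y : Submodule K V // finrank K y = i + 1 ∧ x ≤ y} =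
      ∑ j ∈ Finset.range m, Nat.card K ^ j := by
  have hq : finrank K (V ⧸ x) = m := by
    have := Submodule.finrank_quotient_add_finrank x
    omega
  rw [← card_submodule_finrank_one m hq]
  refine Nat.card_congr (Equiv.symm ?_)
  refine (Equiv.subtypeEquiv (Submodule.comapMkQRelIso x).toEquiv
    (q := fun y => finrank K y.1 = i + 1) fun H => ?_).trans ?_
  · have := finrank_comap_mkQ x H
    change _ ↔ finrank K (H.comap x.mkQ) = _
    omega
  · exact (Equiv.subtypeSubtypeEquivSubtypeInter (fun y => x ≤ y)
      (fun y : Submodule K V => finrank K y = i + 1)).trans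
      (Equiv.subtypeEquivRight fun y => and_comm)

theorem card_cocovers (y : Submodule K V) (i : ℕ) (hy : finrank K y = i + 1) :
    Nat.card {x : Submodule K V // finrank K x = i ∧ x ≤ y} =
      ∑ j ∈ Finset.range (i + 1), Nat.card K ^ j := by
  rw [← card_submodule_finrank_pred i hy]
  refine Nat.card_congr (Equiv.symm ?_)
  refine (Equiv.subtypeEquiv (Submodule.MapSubtype.orderIso y).toEquiv
    (q := fun x => finrank K x.1 = i) fun H => ?_).trans ?_
  · have := Submodule.finrank_map_subtype_eq y H
    change _ ↔ finrank K (H.map y.subtype) = _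
    omega
  · exact (Equiv.subtypeSubtypeEquivSubtypeInter (fun x => x ≤ y)
      (fun x : Submodule K V => finrank K x = i)).trans
      (Equiv.subtypeEquivRight fun y => and_comm)

variable [Fintype (Submodule K V)]

open scoped Classical in
theorem card_filter_covers (x : Submodule K V) (i m : ℕ) (hx : finrank K x = i)
    (hm : finrank K V = i + m) :
    ((subspaces K V (i + 1)).filter (x ≤ ·)).card = ∑ j ∈ Finset.range m, Nat.card K ^ j := by
  rw [← card_covers x i m hx hm, Nat.card_eq_fintype_card, Fintype.card_subtype]
  congr 1
  ext; simp

open scoped Classical in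
theorem card_filter_cocovers (y : Submodule K V) (i : ℕ) (hy : finrank K y = i + 1) :
    ((subspaces K V i).filter (· ≤ y)).card = ∑ j ∈ Finset.range (i + 1), Nat.card K ^ j := by
  rw [← card_cocovers y i hy, Nat.card_eq_fintype_card, Fintype.card_subtype]
  congr 1
  ext; simp

end Counting

/-! ### Random sets of prescribed size. -/

section Averaging

theorem exists_perm_apply_eq {α : Type*} [DecidableEq α] {a b a' b' : α} (h : a ≠ b)
    (h' : a' ≠ b') : ∃ π : Equiv.Perm α, π a = a' ∧ π b = b' := by
  refine ⟨Equiv.swap (Equiv.swap a a' b) b' * Equiv.swap a a', ?_, ?_⟩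
  · rw [Equiv.Perm.mul_apply, Equiv.swap_apply_left]
    apply Equiv.swap_apply_of_ne_of_ne _ h'
    intro e
    rw [← Equiv.swap_apply_left a a'] at e
    exact h ((Equiv.swap a a').injective (by simpa using e))
  · rw [Equiv.Perm.mul_apply, Equiv.swap_apply_left]

open scoped Classical in
/-- A regular graph has a set of any given size whose cut is at most the expected cut of a
uniformly random set of that size. -/
theorem exists_card_eq_edgeCount_le {V : Type*} [Fintype V] (G : SimpleGraph V) (k : ℕ)
    (hG : ∀ x, G.degree x = k) (h : ℕ) (hh : h ≤ Fintype.card V) :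
    ∃ S : Finset V, S.card = h ∧
      edgeCount G S Sᶜ * (Fintype.card V - 1 : ℝ) ≤ h * (Fintype.card V - h : ℝ) * k := by
  obtain ⟨T, -, hT⟩ := Finset.exists_subset_card_eq (s := (Finset.univ : Finset V))
    (n := h) (by simpa using hh)
  set adj : V → V → ℝ := fun x y => if G.Adj x y then 1 else 0 with hadj
  have hcut (S : Finset V) : (edgeCount G S Sᶜ : ℝ) = ∑ x ∈ S, ∑ y ∈ Sᶜ, adj x y := by
    rw [edgeCount, SimpleGraph.interedges_def, ← Finset.sum_product', hadj]
    simp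
  -- Up to normalization, `c a b` is the probability that a random permutation sends (a, b) to an
  -- edge. Double transitivity makes it constant off the diagonal, and the row sum then determines
  -- the constant.
  set c : V → V → ℝ := fun a b => ∑ σ : Equiv.Perm V, adj (σ a) (σ b) with hc
  have hc_const {a b a' b' : V} (hab : a ≠ b) (hab' : a' ≠ b') : c a b = c a' b' := by
    obtain ⟨π, rfl, rfl⟩ := exists_perm_apply_eq hab hab'
    exact (Fintype.sum_equiv (Equiv.mulRight π) _ _ fun σ => rfl).symm
  have hc_row (a : V) : ∑ b, c a b = Fintype.card (Equiv.Perm V) * k := by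
    rw [hc, Finset.sum_comm]
    have (σ : Equiv.Perm V) : ∑ b, adj (σ a) (σ b) = k := by
      rw [Equiv.sum_comp σ (fun b => adj (σ a) b), hadj]
      simp [← hG (σ a), ← SimpleGraph.card_neighborFinset_eq_degree,
        SimpleGraph.neighborFinset_eq_filter]
    simp [this]
  have hc_val {a b : V} (hab : a ≠ b) :
      c a b * (Fintype.card V - 1 : ℝ) = Fintype.card (Equiv.Perm V) * k := by
    rw [← hc_row a, ← Finset.add_sum_erase _ _ (Finset.mem_univ a)]
    rw [Finset.sum_congr rfl fun b' hb' => hc_const (Finset.ne_of_mem_erase hb').symm hab]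
    have h0 : c a a = 0 := by simp [hc, hadj]
    have : 1 ≤ Fintype.card V := Fintype.card_pos_iff.2 ⟨a⟩
    rw [h0, zero_add, Finset.sum_const, Finset.card_erase_of_mem (Finset.mem_univ a),
      Finset.card_univ, nsmul_eq_mul, Nat.cast_sub this]
    push_cast
    ring
  have hmap (σ : Equiv.Perm V) : (edgeCount G (T.map σ.toEmbedding) (T.map σ.toEmbedding)ᶜ : ℝ) =
      ∑ a ∈ T, ∑ b ∈ Tᶜ, adj (σ a) (σ b) := by
    have : (T.map σ.toEmbedding)ᶜ = Tᶜ.map σ.toEmbedding := by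
      ext x; simp
    rw [hcut, this]
    simp
  have htot : ∑ σ : Equiv.Perm V, (edgeCount G (T.map σ.toEmbedding) (T.map σ.toEmbedding)ᶜ : ℝ) *
      (Fintype.card V - 1 : ℝ) = ∑ _σ : Equiv.Perm V, h * (Fintype.card V - h : ℝ) * k := by
    rw [← Finset.sum_mul]
    simp_rw [hmap]
    rw [Finset.sum_comm]
    simp_rw [Finset.sum_comm (s := Finset.univ) (t := Tᶜ)]
    rw [Finset.sum_mul]
    have : ∀ a ∈ T, (∑ b ∈ Tᶜ, c a b) * (Fintype.card V - 1 : ℝ) =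
        (Fintype.card V - h : ℝ) * (Fintype.card (Equiv.Perm V) * k) := by
      intro a ha
      rw [Finset.sum_mul, Finset.sum_congr rfl fun b hb => hc_val (a := a) (b := b) ?_]
      · rw [Finset.sum_const, Finset.card_compl, hT, nsmul_eq_mul, Nat.cast_sub hh]
      · rintro rfl
        exact Finset.mem_compl.1 hb ha
    rw [Finset.sum_congr rfl this]
    simp only [Finset.sum_const, hT, nsmul_eq_mul, Finset.card_univ]
    ring
  obtain ⟨σ, -, hσ⟩ := Finset.exists_le_of_sum_le Finset.univ_nonempty htot.le
  exact ⟨T.map σ.toEmbedding, by simpa using hT, hσ⟩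

end Averaging

/-! ### Incidence operators and their transposes. -/

section Incidence

variable {α β : Type*} (X : Finset α) (Y : Finset β) (r : α → β → Prop)

open scoped Classical in
-- This is ‖Uf‖² = ⟨f, UᵀUf⟩: the entries of UᵀU count common neighbours.
theorem sum_sq_sum_filter (f : α → ℝ) :
    ∑ y ∈ Y, (∑ x ∈ X with r x y, f x) ^ 2 =
      ∑ x ∈ X, ∑ x' ∈ X, ((Y.filter fun y => r x y ∧ r x' y).card : ℝ) * (f x * f x') := by
  have (y : β) : (∑ x ∈ X with r x y, f x) ^ 2 =
      ∑ x ∈ X, ∑ x' ∈ X, (if r x y ∧ r x' y then 1 else 0) * (f x * f x') := by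
    rw [sq, Finset.sum_filter, Finset.sum_mul_sum]
    refine Finset.sum_congr rfl fun x _ => Finset.sum_congr rfl fun x' _ => ?_
    by_cases h : r x y <;> by_cases h' : r x' y <;> simp [h, h']
  simp_rw [this]
  rw [Finset.sum_comm]
  refine Finset.sum_congr rfl fun x _ => ?_
  rw [Finset.sum_comm]
  refine Finset.sum_congr rfl fun x' _ => ?_
  rw [← Finset.sum_mul, Finset.sum_boole]

open scoped Classical in
theorem sum_mul_sum_filter (f : α → ℝ) (g : β → ℝ) :
    ∑ y ∈ Y, g y * (∑ x ∈ X with r x y, f x) = ∑ x ∈ X, f x * (∑ y ∈ Y with r x y, g y) := by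
  simp_rw [Finset.sum_filter, Finset.mul_sum]
  rw [Finset.sum_comm]
  refine Finset.sum_congr rfl fun x _ => Finset.sum_congr rfl fun y _ => ?_
  split_ifs <;> ring

open scoped Classical in
/-- An incidence operator and its transpose obey the same bound on the complement of the constants. -/
theorem sum_sq_transpose_le {c : ℝ} (hc : 0 ≤ c)
    (hU : ∀ f : α → ℝ, ∑ x ∈ X, f x = 0 →
      ∑ y ∈ Y, (∑ x ∈ X with r x y, f x) ^ 2 ≤ c * ∑ x ∈ X, f x ^ 2)
    (d : ℕ) (hd : ∀ y ∈ Y, (X.filter (r · y)).card = d) (g : β → ℝ) (hg : ∑ y ∈ Y, g y = 0) :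
    ∑ x ∈ X, (∑ y ∈ Y with r x y, g y) ^ 2 ≤ c * ∑ y ∈ Y, g y ^ 2 := by
  set f : α → ℝ := fun x => ∑ y ∈ Y with r x y, g y with hf
  have hf0 : ∑ x ∈ X, f x = 0 := by
    have := sum_mul_sum_filter X Y r (fun _ => 1) g
    simp only [one_mul, Finset.sum_const, nsmul_eq_mul, mul_one] at this
    rw [hf, ← this, Finset.sum_congr rfl fun y hy => by rw [hd y hy], ← Finset.sum_mul, hg,
      zero_mul]
  have hadj := sum_mul_sum_filter X Y r f g
  have hff : ∑ x ∈ X, f x * (∑ y ∈ Y with r x y, g y) = ∑ x ∈ X, f x ^ 2 :=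
    Finset.sum_congr rfl fun x _ => (sq _).symm
  rw [hff] at hadj
  -- With f = Uᵀg, Cauchy–Schwarz gives ‖f‖⁴ = ⟨g, Uf⟩² ≤ ‖g‖²‖Uf‖² ≤ c‖g‖²‖f‖²; then ‖f‖² cancels
  -- unless it is zero.
  have hcs := Finset.sum_mul_sq_le_sq_mul_sq Y g (fun y => ∑ x ∈ X with r x y, f x)
  rw [hadj] at hcs
  have hG : 0 ≤ ∑ y ∈ Y, g y ^ 2 := Finset.sum_nonneg fun _ _ => sq_nonneg _
  have hN : 0 ≤ ∑ x ∈ X, f x ^ 2 := Finset.sum_nonneg fun _ _ => sq_nonneg _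
  rcases hN.eq_or_lt with h0 | hpos
  · rw [← h0]
    positivity
  · have := hcs.trans (mul_le_mul_of_nonneg_left (hU f hf0) hG)
    refine le_of_mul_le_mul_right ?_ hpos
    linarith

end Incidence

/-! ### The norm of the inclusion operators between layers. -/

section Grassmann

open Module

variable {K V : Type*} [Field K] [Finite K] [AddCommGroup V] [Module K V] [FiniteDimensional K V]
  [Fintype (Submodule K V)]

/-- The `q`-analogue `1 + q + ⋯ + q ^ (n - 1)` of `n`. -/
def qNumber (q n : ℕ) : ℕ := ∑ j ∈ Finset.range n, q ^ j

theorem qNumber_mono (q : ℕ) : Monotone (qNumber q) := fun _ _ h =>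
  Finset.sum_le_sum_of_subset (Finset.range_mono h)

theorem qNumber_add (q m n : ℕ) : qNumber q (m + n) = qNumber q m + q ^ m * qNumber q n := by
  simp [qNumber, Finset.sum_range_add, Finset.mul_sum, pow_add]

theorem qNumber_succ (q n : ℕ) : qNumber q (n + 1) = 1 + q * qNumber q n := by
  rw [add_comm, qNumber_add]
  simp [qNumber]

open scoped Classical in
-- Off-diagonal terms cancel by `card_common_covers`; the diagonal leaves the number of covers minus
-- the number of cocovers.
theorem sum_sq_up_sub_sum_sq_down (i m : ℕ) (hV : finrank K V = i + 1 + m)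
    (f : Submodule K V → ℝ) :
    ∑ y ∈ subspaces K V (i + 2), (∑ x ∈ subspaces K V (i + 1) with x ≤ y, f x) ^ 2 =
      ∑ z ∈ subspaces K V i, (∑ x ∈ subspaces K V (i + 1) with z ≤ x, f x) ^ 2 +
        ((qNumber (Nat.card K) m : ℝ) - qNumber (Nat.card K) (i + 1)) *
          ∑ x ∈ subspaces K V (i + 1), f x ^ 2 := by
  rw [sum_sq_sum_filter (subspaces K V (i + 1)) (subspaces K V (i + 2)) (fun x y => x ≤ y),
    sum_sq_sum_filter (subspaces K V (i + 1)) (subspaces K V i) (fun x z => z ≤ x),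
    Finset.mul_sum, ← Finset.sum_add_distrib]
  refine Finset.sum_congr rfl fun x hx => ?_
  rw [← Finset.add_sum_erase _ _ hx, ← Finset.add_sum_erase _ _ hx]
  have h1 := card_filter_covers x (i + 1) m (mem_subspaces.1 hx) hV
  have h2 := card_filter_cocovers x i (mem_subspaces.1 hx)
  rw [Finset.sum_congr rfl fun x' hx' => by
    rw [card_common_covers (mem_subspaces.1 hx) (mem_subspaces.1 (Finset.mem_of_mem_erase hx'))
      (Finset.ne_of_mem_erase hx').symm]]
  simp only [and_self, h1, h2, qNumber]
  ring

open scoped Classical in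
/-- The inclusion operator between consecutive layers, restricted to functions of sum zero. -/
theorem sum_sq_up_le (i m : ℕ) (hV : finrank K V = i + i + m) (f : Submodule K V → ℝ)
    (hf : ∑ x ∈ subspaces K V i, f x = 0) :
    ∑ y ∈ subspaces K V (i + 1), (∑ x ∈ subspaces K V i with x ≤ y, f x) ^ 2 ≤
      (∑ j ∈ Finset.range i, ((qNumber (Nat.card K) (i + i + m - (j + 1)) : ℝ) -
        qNumber (Nat.card K) (j + 1))) * ∑ x ∈ subspaces K V i, f x ^ 2 := by
  induction i generalizing m f with
  | zero =>
    have h0 : subspaces K V 0 = {⊥} := by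
      ext W
      simp
    rw [h0, Finset.sum_singleton] at hf
    have (y : Submodule K V) : ∑ x ∈ subspaces K V 0 with x ≤ y, f x = 0 :=
      Finset.sum_eq_zero fun x hx => by
        rw [h0, Finset.mem_filter, Finset.mem_singleton] at hx
        rw [hx.1, hf]
    simp [this]
  | succ i ih =>
    -- The ambient dimension is fixed, so one layer lower the slack m grows by 2.
    have hsplit : i + 1 + (i + 1) + m = i + i + (m + 2) := by omega
    rw [sum_sq_up_sub_sum_sq_down i (i + 1 + m) (by omega) f, Finset.sum_range_succ, add_mul,
      hsplit]
    have hidx : i + i + (m + 2) - (i + 1) = i + 1 + m := by omega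
    rw [hidx]
    gcongr
    refine sum_sq_transpose_le (subspaces K V i) (subspaces K V (i + 1)) (fun z x => z ≤ x)
      (Finset.sum_nonneg fun j hj => ?_) (ih (m + 2) (by omega)) _
      (fun y hy => card_filter_cocovers y i (mem_subspaces.1 hy)) f hf
    -- Below the middle layer a subspace has at least as many covers as cocovers.
    rw [sub_nonneg, Nat.cast_le]
    have := Finset.mem_range.1 hj
    exact qNumber_mono _ (by omega)

/-- After reversing the first sum, each term is [j+1+t] - [j+1] = q^(j+1)[t]. -/
theorem sum_qNumber_sub (q t : ℕ) :
    ∑ j ∈ Finset.range t, ((qNumber q (t + t + 1 - (j + 1)) : ℝ) - qNumber q (j + 1)) =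
      q * (qNumber q t : ℝ) ^ 2 := by
  rw [Finset.sum_sub_distrib]
  have : ∑ j ∈ Finset.range t, (qNumber q (t + t + 1 - (j + 1)) : ℝ) =
      ∑ j ∈ Finset.range t, (qNumber q (j + 1 + t) : ℝ) := by
    rw [← Finset.sum_range_reflect]
    refine Finset.sum_congr rfl fun j hj => ?_
    have := Finset.mem_range.1 hj
    congr 2
    omega
  rw [this, ← Finset.sum_sub_distrib]
  simp only [qNumber_add q _ t, Nat.cast_add, Nat.cast_mul, add_sub_cancel_left]
  rw [← Finset.sum_mul]
  have : ∑ j ∈ Finset.range t, ((q ^ (j + 1) : ℕ) : ℝ) = q * (qNumber q t : ℝ) := by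
    simp [qNumber, Finset.mul_sum, pow_succ']
  rw [this]
  ring

end Grassmann

open scoped Classical in
theorem mem_positiveLaplacianEigenvalues_iff_of_regular {V : Type*} [Fintype V]
    (G : SimpleGraph V) {k : ℕ} (hk : 0 < k) (hG : ∀ x, G.degree x = k) {l : ℝ} :
    l ∈ positiveLaplacianEigenvalues G ↔
      0 < l ∧ ∃ v : V → ℝ, v ≠ 0 ∧ ∀ x, ∑ y ∈ G.neighborFinset x, v y = k * (1 - l) * v x := by
  have hk' : (k : ℝ) ≠ 0 := by positivity
  rw [positiveLaplacianEigenvalues, Set.mem_ofPred_eq]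
  refine and_congr_right fun _ => ?_
  have key (v : V → ℝ) : Matrix.toLin' (laplacian G) v = l • v ↔
      ∀ x, ∑ y ∈ G.neighborFinset x, v y = k * (1 - l) * v x := by
    rw [laplacian_eq_of_regular G k hk hG, Matrix.toLin'_apply, Matrix.sub_mulVec,
      Matrix.one_mulVec, Matrix.smul_mulVec, funext_iff]
    refine forall_congr' fun x => ?_
    rw [Pi.sub_apply, Pi.smul_apply, Pi.smul_apply, SimpleGraph.adjMatrix_mulVec_apply,
      smul_eq_mul, smul_eq_mul]
    field_simp
    constructor <;> intro h <;> linarith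
  constructor
  · intro h
    obtain ⟨v, hv⟩ := h.exists_hasEigenvector
    exact ⟨v, hv.2, (key v).1 hv.apply_eq_smul⟩
  · rintro ⟨v, hv0, hv⟩
    exact Module.End.hasEigenvalue_of_hasEigenvector
      ⟨Module.End.mem_eigenspace_iff.2 ((key v).2 hv), hv0⟩

/-! ### Spectrum and cut of the doubled Grassmann graph. -/

section DoubledGrassmann

open Module

variable {F : Type*} [Field F] {t : ℕ}

theorem finrank_doubledGrassmannVertex_ambient (F : Type*) [Field F] (t : ℕ) :
    finrank F (Fin (2 * t + 1) → F) = t + t + 1 := by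
  rw [finrank_fin_fun]
  omega

theorem nonempty_doubledGrassmannVertex (F : Type*) [Field F] (t : ℕ) :
    Nonempty (DoubledGrassmannVertex F t) := by
  have hli := (Pi.basisFun F (Fin (2 * t + 1))).linearIndependent.comp
    (Fin.castLE (n := t) (by omega)) (Fin.castLE_injective _)
  exact ⟨⟨_, Or.inl ((finrank_span_eq_card hli).trans (Fintype.card_fin t))⟩⟩

theorem doubledGrassmannGraph_adj_iff_of_finrank_eq {x y : DoubledGrassmannVertex F t}
    (hx : finrank F x.1 = t) :
    (doubledGrassmannGraph F t).Adj x y ↔ finrank F y.1 = t + 1 ∧ x.1 ≤ y.1 := by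
  constructor
  · rintro ⟨hne, h⟩
    have key : finrank F y.1 ≠ t := by
      intro hy
      apply hne
      rcases h with h | h
      · exact Subtype.ext (Submodule.eq_of_le_of_finrank_eq h (by rw [hx, hy]))
      · exact Subtype.ext (Submodule.eq_of_le_of_finrank_eq h (by rw [hx, hy])).symm
    have hy := y.2.resolve_left key
    refine ⟨hy, h.resolve_right fun h' => ?_⟩
    have := Submodule.finrank_mono h'
    omega
  · rintro ⟨hy, h⟩
    refine ⟨?_, Or.inl h⟩
    rintro rfl
    omega

theorem doubledGrassmannGraph_adj_iff_of_finrank_eq_succ {x y : DoubledGrassmannVertex F t}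
    (hx : finrank F x.1 = t + 1) :
    (doubledGrassmannGraph F t).Adj x y ↔ finrank F y.1 = t ∧ y.1 ≤ x.1 := by
  rw [SimpleGraph.adj_comm]
  constructor
  · intro h
    rcases y.2 with hy | hy
    · exact ⟨hy, ((doubledGrassmannGraph_adj_iff_of_finrank_eq hy).1 h).2⟩
    · have hne := h.1
      rcases h.2 with h' | h'
      · exact absurd (Subtype.ext (Submodule.eq_of_le_of_finrank_eq h' (by rw [hx, hy]))) hne
      · exact absurd (Subtype.ext (Submodule.eq_of_le_of_finrank_eq h' (by rw [hx, hy]))).symm hne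
  · rintro ⟨hy, h⟩
    exact (doubledGrassmannGraph_adj_iff_of_finrank_eq hy).2 ⟨hx, h⟩

variable [Finite F] [Fintype (Submodule F (Fin (2 * t + 1) → F))]

open scoped Classical in
theorem map_neighborFinset_of_finrank_eq {x : DoubledGrassmannVertex F t}
    (hx : finrank F x.1 = t) :
    ((doubledGrassmannGraph F t).neighborFinset x).map (Function.Embedding.subtype _) =
      (subspaces F (Fin (2 * t + 1) → F) (t + 1)).filter (x.1 ≤ ·) := by
  ext W
  simp only [Finset.mem_map, SimpleGraph.mem_neighborFinset,
    doubledGrassmannGraph_adj_iff_of_finrank_eq hx, Function.Embedding.subtype_apply,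
    Finset.mem_filter, mem_subspaces]
  constructor
  · rintro ⟨y, h, rfl⟩
    exact h
  · intro h
    exact ⟨⟨W, Or.inr h.1⟩, h, rfl⟩

open scoped Classical in
theorem map_neighborFinset_of_finrank_eq_succ {x : DoubledGrassmannVertex F t}
    (hx : finrank F x.1 = t + 1) :
    ((doubledGrassmannGraph F t).neighborFinset x).map (Function.Embedding.subtype _) =
      (subspaces F (Fin (2 * t + 1) → F) t).filter (· ≤ x.1) := by
  ext W
  simp only [Finset.mem_map, SimpleGraph.mem_neighborFinset,
    doubledGrassmannGraph_adj_iff_of_finrank_eq_succ hx, Function.Embedding.subtype_apply,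
    Finset.mem_filter, mem_subspaces]
  constructor
  · rintro ⟨y, h, rfl⟩
    exact h
  · intro h
    exact ⟨⟨W, Or.inl h.1⟩, h, rfl⟩

omit [Fintype (Submodule F (Fin (2 * t + 1) → F))] in
open scoped Classical in
theorem degree_doubledGrassmannGraph (x : DoubledGrassmannVertex F t) :
    (doubledGrassmannGraph F t).degree x = qNumber (Nat.card F) (t + 1) := by
  have := Fintype.ofFinite (Submodule F (Fin (2 * t + 1) → F))
  rw [← SimpleGraph.card_neighborFinset_eq_degree,
    ← Finset.card_map (Function.Embedding.subtype _)]
  rcases x.2 with hx | hx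
  · rw [map_neighborFinset_of_finrank_eq hx, card_filter_covers x.1 t (t + 1) hx
      (finrank_doubledGrassmannVertex_ambient F t), qNumber]
  · rw [map_neighborFinset_of_finrank_eq_succ hx, card_filter_cocovers x.1 t hx, qNumber]

open scoped Classical in
theorem sum_mul_qNumber_eq_sum_sum_up (f : Submodule F (Fin (2 * t + 1) → F) → ℝ) :
    ∑ y ∈ subspaces F (Fin (2 * t + 1) → F) (t + 1),
        ∑ x ∈ subspaces F (Fin (2 * t + 1) → F) t with x ≤ y, f x =
      (∑ x ∈ subspaces F (Fin (2 * t + 1) → F) t, f x) * qNumber (Nat.card F) (t + 1) := by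
  have := sum_mul_sum_filter (subspaces F (Fin (2 * t + 1) → F) t)
    (subspaces F (Fin (2 * t + 1) → F) (t + 1)) (fun x y => x ≤ y) f (fun _ => 1)
  simp only [one_mul, Finset.sum_const, nsmul_eq_mul, mul_one] at this
  rw [this, Finset.sum_mul]
  refine Finset.sum_congr rfl fun x hx => ?_
  rw [card_filter_covers x t (t + 1) (mem_subspaces.1 hx)
      (finrank_doubledGrassmannVertex_ambient F t), qNumber]

open scoped Classical in
theorem sum_mul_qNumber_eq_sum_sum_down (f : Submodule F (Fin (2 * t + 1) → F) → ℝ) :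
    ∑ x ∈ subspaces F (Fin (2 * t + 1) → F) t,
        ∑ y ∈ subspaces F (Fin (2 * t + 1) → F) (t + 1) with x ≤ y, f y =
      (∑ y ∈ subspaces F (Fin (2 * t + 1) → F) (t + 1), f y) * qNumber (Nat.card F) (t + 1) := by
  have := sum_mul_sum_filter (subspaces F (Fin (2 * t + 1) → F) t)
    (subspaces F (Fin (2 * t + 1) → F) (t + 1)) (fun x y => x ≤ y) (fun _ => 1) f
  simp only [one_mul, Finset.sum_const, nsmul_eq_mul, mul_one] at this
  rw [← this, Finset.sum_mul]
  refine Finset.sum_congr rfl fun y hy => ?_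
  rw [card_filter_cocovers y t (mem_subspaces.1 hy), qNumber]

theorem qNumber_succ_pos (q t : ℕ) : 0 < qNumber q (t + 1) := by
  rw [qNumber_succ]
  omega

/-- Count incident pairs: every middle subspace has the same positive degree [t+1]. -/
theorem card_subspaces_middle :
    (subspaces F (Fin (2 * t + 1) → F) (t + 1)).card =
      (subspaces F (Fin (2 * t + 1) → F) t).card := by
  classical
  have h := sum_mul_qNumber_eq_sum_sum_up (F := F) (t := t) (fun _ => 1)
  simp only [Finset.sum_const, nsmul_eq_mul, mul_one] at h
  rw [Finset.sum_congr rfl fun y hy => by rw [card_filter_cocovers y t (mem_subspaces.1 hy)]] at h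
  rw [Finset.sum_const, nsmul_eq_mul, qNumber] at h
  have hpos : (0 : ℝ) < (qNumber (Nat.card F) (t + 1) : ℕ) := by
    exact_mod_cast qNumber_succ_pos _ _
  exact_mod_cast mul_right_cancel₀ hpos.ne' h

omit [Fintype (Submodule F (Fin (2 * t + 1) → F))] in
theorem even_card_doubledGrassmannVertex :
    Even (Fintype.card (DoubledGrassmannVertex F t)) := by
  classical
  have := Fintype.ofFinite (Submodule F (Fin (2 * t + 1) → F))
  have h : (Finset.univ : Finset (DoubledGrassmannVertex F t)).map (Function.Embedding.subtype _) =
      subspaces F (Fin (2 * t + 1) → F) t ∪ subspaces F (Fin (2 * t + 1) → F) (t + 1) := by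
    ext W
    simp
  refine ⟨(subspaces F (Fin (2 * t + 1) → F) t).card, ?_⟩
  rw [← Finset.card_univ, ← Finset.card_map (Function.Embedding.subtype _), h,
    Finset.card_union_of_disjoint, card_subspaces_middle]
  rw [Finset.disjoint_left]
  intro W h1 h2
  rw [mem_subspaces] at h1 h2
  omega

open scoped Classical in
/-- An eigenvalue of the inclusion relation between the two middle layers that is positive and
smaller than the valency is at most half the valency. -/
theorem two_mul_add_one_le_of_eigenvector (hq : 4 ≤ Nat.card F) {θ : ℝ} (hθ : 0 < θ)
    (hθk : θ < qNumber (Nat.card F) (t + 1)) (f : Submodule F (Fin (2 * t + 1) → F) → ℝ)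
    (hup : ∀ y ∈ subspaces F (Fin (2 * t + 1) → F) (t + 1),
      ∑ x ∈ subspaces F (Fin (2 * t + 1) → F) t with x ≤ y, f x = θ * f y)
    (hdown : ∀ x ∈ subspaces F (Fin (2 * t + 1) → F) t,
      ∑ y ∈ subspaces F (Fin (2 * t + 1) → F) (t + 1) with x ≤ y, f y = θ * f x)
    (hf : ∃ x : Submodule F (Fin (2 * t + 1) → F), (finrank F x = t ∨ finrank F x = t + 1) ∧ f x ≠ 0) :
    2 * θ + 1 ≤ qNumber (Nat.card F) (t + 1) := by
  set X := subspaces F (Fin (2 * t + 1) → F) t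
  set Y := subspaces F (Fin (2 * t + 1) → F) (t + 1)
  have h1 := sum_mul_qNumber_eq_sum_sum_up f
  have h2 := sum_mul_qNumber_eq_sum_sum_down f
  rw [Finset.sum_congr rfl hup, ← Finset.mul_sum] at h1
  rw [Finset.sum_congr rfl hdown, ← Finset.mul_sum] at h2
  have hk : (qNumber (Nat.card F) (t + 1) : ℝ) = 1 + Nat.card F * qNumber (Nat.card F) t := by
    rw [qNumber_succ]; push_cast; rfl
  have hsum : ∑ x ∈ X, f x = 0 := by
    -- Summing the eigenvector equations over each layer gives (k² - θ²) ∑ f = 0 on layer t.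
    have : (∑ x ∈ X, f x) * (((qNumber (Nat.card F) (t + 1) : ℝ) - θ) *
        ((qNumber (Nat.card F) (t + 1) : ℝ) + θ)) = 0 := by
      linear_combination (-(qNumber (Nat.card F) (t + 1) : ℝ)) * h1 - θ * h2
    refine (mul_eq_zero.1 this).resolve_right (mul_pos (by linarith) (by linarith)).ne'
  have hle := sum_sq_up_le t 1 (finrank_doubledGrassmannVertex_ambient F t) f hsum
  rw [sum_qNumber_sub, Finset.sum_congr rfl fun y hy => by rw [hup y hy, mul_pow],
    ← Finset.mul_sum] at hle
  have hXY : ∑ y ∈ Y, f y ^ 2 = ∑ x ∈ X, f x ^ 2 := by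
    have := sum_mul_sum_filter X Y (fun x y => x ≤ y) f f
    rw [Finset.sum_congr (s₁ := Y) rfl fun y hy => by rw [hup y hy],
      Finset.sum_congr (s₁ := X) rfl fun x hx => by rw [hdown x hx]] at this
    have e (Z : Finset (Submodule F (Fin (2 * t + 1) → F))) :
        ∑ x ∈ Z, f x * (θ * f x) = θ * ∑ x ∈ Z, f x ^ 2 := by
      rw [Finset.mul_sum]
      exact Finset.sum_congr rfl fun x _ => by ring
    rw [e, e] at this
    exact mul_left_cancel₀ hθ.ne' this
  rw [hXY] at hle
  have hpos : 0 < ∑ x ∈ X, f x ^ 2 := by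
    obtain ⟨x, hx | hx, hfx⟩ := hf
    · exact Finset.sum_pos' (fun _ _ => sq_nonneg _) ⟨x, mem_subspaces.2 hx, by positivity⟩
    · rw [← hXY]
      exact Finset.sum_pos' (fun _ _ => sq_nonneg _) ⟨x, mem_subspaces.2 hx, by positivity⟩
  have hsq := le_of_mul_le_mul_right hle hpos
  rw [hk]
  have hq' : (4 : ℝ) ≤ Nat.card F := by exact_mod_cast hq
  -- The only use of q ≥ 4: 4θ² ≤ 4q[t]² ≤ q²[t]².
  have : (2 * θ) ^ 2 ≤ ((Nat.card F : ℝ) * qNumber (Nat.card F) t) ^ 2 := by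
    have hm : 0 ≤ ((Nat.card F : ℝ) - 4) * (Nat.card F * (qNumber (Nat.card F) t : ℝ) ^ 2) :=
      mul_nonneg (by linarith) (by positivity)
    linarith
  linarith [le_of_abs_le <| abs_le_of_sq_le_sq this (by positivity)]

omit [Fintype (Submodule F (Fin (2 * t + 1) → F))] in
theorem le_of_mem_positiveLaplacianEigenvalues (hq : 4 ≤ Nat.card F) {l : ℝ}
    (hl : l ∈ positiveLaplacianEigenvalues (doubledGrassmannGraph F t)) :
    (qNumber (Nat.card F) (t + 1) + 1 : ℝ) / (2 * qNumber (Nat.card F) (t + 1)) ≤ l := by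
  classical
  have := Fintype.ofFinite (Submodule F (Fin (2 * t + 1) → F))
  obtain ⟨hl0, v, hv0, hA⟩ := (mem_positiveLaplacianEigenvalues_iff_of_regular _
    (qNumber_succ_pos (Nat.card F) t) degree_doubledGrassmannGraph).1 hl
  set k : ℝ := (qNumber (Nat.card F) (t + 1) : ℝ) with hk
  have hk1 : (1 : ℝ) ≤ k := Nat.one_le_cast.2 (qNumber_succ_pos (Nat.card F) t)
  have hk0 : 0 < k := by linarith
  rw [div_le_iff₀ (by positivity)]
  -- If l ≥ 1, then k ≥ 1 suffices; otherwise θ = k(1-l) lies strictly between 0 and k.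
  rcases le_or_gt 1 l with h1 | h1
  · nlinarith
  set f : Submodule F (Fin (2 * t + 1) → F) → ℝ := fun W =>
    if h : finrank F W = t ∨ finrank F W = t + 1 then v ⟨W, h⟩ else 0 with hf
  have hfv (x : DoubledGrassmannVertex F t) : f x.1 = v x := by
    rw [hf]
    exact dif_pos x.2
  have hmap (x) : ∑ W ∈ ((doubledGrassmannGraph F t).neighborFinset x).map
      (Function.Embedding.subtype _), f W = k * (1 - l) * f x.1 := by
    rw [Finset.sum_map, hfv, ← hA]
    exact Finset.sum_congr rfl fun y _ => hfv y
  have hle := two_mul_add_one_le_of_eigenvector hq (θ := k * (1 - l))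
    (mul_pos hk0 (by linarith)) (by rw [← hk]; nlinarith) f
    (fun y hy => by
      have hy' := mem_subspaces.1 hy
      have := hmap ⟨y, Or.inr hy'⟩
      rwa [map_neighborFinset_of_finrank_eq_succ hy'] at this)
    (fun x hx => by
      have hx' := mem_subspaces.1 hx
      have := hmap ⟨x, Or.inl hx'⟩
      rwa [map_neighborFinset_of_finrank_eq hx'] at this)
    (by
      obtain ⟨x, hx⟩ := Function.ne_iff.1 hv0
      exact ⟨x.1, x.2, by rw [hfv]; exact hx⟩)
  rw [← hk] at hle
  linarith

omit [Fintype (Submodule F (Fin (2 * t + 1) → F))] in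
-- The bipartition signs give the eigenvalue 2. Thus the set of positive eigenvalues is nonempty,
-- and the `sInf` in `lambdaOne` is a true minimum rather than the default 0.
theorem two_mem_positiveLaplacianEigenvalues :
    2 ∈ positiveLaplacianEigenvalues (doubledGrassmannGraph F t) := by
  classical
  refine (mem_positiveLaplacianEigenvalues_iff_of_regular _ (qNumber_succ_pos (Nat.card F) t)
    degree_doubledGrassmannGraph).2
    ⟨two_pos, fun x => if finrank F x.1 = t then 1 else -1, ?_, fun x => ?_⟩
  · obtain ⟨x⟩ := nonempty_doubledGrassmannVertex F t
    intro h
    have := congrFun h x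
    simp only [Pi.zero_apply] at this
    split_ifs at this <;> norm_num at this
  · dsimp only
    rcases x.2 with hx | hx
    · rw [Finset.sum_congr rfl fun y hy => if_neg (c := finrank F y.1 = t) (by
        have := (doubledGrassmannGraph_adj_iff_of_finrank_eq hx).1
          ((SimpleGraph.mem_neighborFinset _ _ _).1 hy)
        omega)]
      rw [Finset.sum_const, SimpleGraph.card_neighborFinset_eq_degree,
        degree_doubledGrassmannGraph]
      simp only [hx, if_true, nsmul_eq_mul]
      ring
    · rw [Finset.sum_congr rfl fun y hy => if_pos (c := finrank F y.1 = t)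
        ((doubledGrassmannGraph_adj_iff_of_finrank_eq_succ hx).1
          ((SimpleGraph.mem_neighborFinset _ _ _).1 hy)).1]
      rw [Finset.sum_const, SimpleGraph.card_neighborFinset_eq_degree,
        degree_doubledGrassmannGraph]
      have : ¬ finrank F x.1 = t := by omega
      simp only [this, if_false, nsmul_eq_mul]
      ring

omit [Fintype (Submodule F (Fin (2 * t + 1) → F))] in
theorem isLeast_lambdaOne_doubledGrassmannGraph :
    IsLeast (positiveLaplacianEigenvalues (doubledGrassmannGraph F t))
      (lambdaOne (doubledGrassmannGraph F t)) := by
  have hfin : (positiveLaplacianEigenvalues (doubledGrassmannGraph F t)).Finite :=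
    (Module.End.finite_hasEigenvalue _).subset fun _ h => h.2
  exact ⟨Set.Nonempty.csInf_mem ⟨(2 : ℝ), two_mem_positiveLaplacianEigenvalues⟩ hfin,
    fun _ h => csInf_le hfin.bddBelow h⟩

omit [Fintype (Submodule F (Fin (2 * t + 1) → F))] in
theorem isOK_doubledGrassmannGraph (hq : 4 ≤ Nat.card F) : IsOK (doubledGrassmannGraph F t) := by
  classical
  obtain ⟨h, hh⟩ := even_card_doubledGrassmannVertex (F := F) (t := t)
  obtain ⟨x⟩ := nonempty_doubledGrassmannVertex F t
  obtain ⟨S, hS, hcut⟩ := exists_card_eq_edgeCount_le (doubledGrassmannGraph F t) _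
    degree_doubledGrassmannGraph h (by omega)
  have hpos : 0 < h := by
    have := Fintype.card_pos_iff.2 ⟨x⟩
    omega
  refine ⟨S, ⟨Finset.card_pos.1 (by omega), ?_⟩, ?_⟩
  · rw [hS, hh]
    push_cast
    linarith
  refine le_trans ?_ (le_of_mem_positiveLaplacianEigenvalues hq
    isLeast_lambdaOne_doubledGrassmannGraph.1)
  have hvol : vol (doubledGrassmannGraph F t) S = h * qNumber (Nat.card F) (t + 1) := by
    simp [vol, degree_doubledGrassmannGraph, hS]
  have hdeg := (doubledGrassmannGraph F t).degree_lt_card_verts x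
  rw [degree_doubledGrassmannGraph, hh] at hdeg
  have hk0 := qNumber_succ_pos (Nat.card F) t
  rw [cheegerRatio, hvol]
  rw [hh] at hcut
  push_cast at hcut ⊢
  generalize qNumber (Nat.card F) (t + 1) = k at *
  have hdeg' : (k : ℝ) + 1 ≤ h + h := by exact_mod_cast hdeg
  have hk0' : (0 : ℝ) < k := by exact_mod_cast hk0
  have hpos' : (0 : ℝ) < h := by exact_mod_cast hpos
  have hn : (0 : ℝ) < h + h - 1 := by linarith
  refine le_of_mul_le_mul_right ?_ hn
  rw [div_mul_eq_mul_div, div_mul_eq_mul_div, div_le_div_iff₀ (by positivity) (by positivity)]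
  have h1 := mul_le_mul_of_nonneg_right hcut (show (0 : ℝ) ≤ 2 * k by positivity)
  -- After clearing denominators, h/(2h-1) ≤ (k+1)/(2k) amounts to k ≤ 2h-1, which holds because a
  -- valency is less than |V| = 2h.
  have h2 : 0 ≤ (h * k : ℝ) * (h + h - 1 - k) := mul_nonneg (by positivity) (by linarith)
  linarith

end DoubledGrassmann

theorem cheegerConstant_le_of_isOK {V : Type*} [Fintype V] {G : SimpleGraph V} (h : IsOK G) :
    cheegerConstant G ≤ lambdaOne G := by
  obtain ⟨S, hS, hle⟩ := h
  unfold cheegerConstant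
  refine (csInf_le ⟨0, ?_⟩ (Set.mem_ofPred.2 ⟨S, hS, rfl⟩)).trans hle
  rintro _ ⟨T, -, rfl⟩
  exact div_nonneg (Nat.cast_nonneg _) (Nat.cast_nonneg _)

end CheegerGraph

theorem mainTheorem3 (F : Type*) [Field F] [Fintype F] (q : ℕ) (hF : Fintype.card F = q)
    (hq : 4 ≤ q) (t : ℕ) :
    IsLeast
        (CheegerGraph.positiveLaplacianEigenvalues (CheegerGraph.doubledGrassmannGraph F t))
        (CheegerGraph.lambdaOne (CheegerGraph.doubledGrassmannGraph F t)) ∧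
      CheegerGraph.IsOK (CheegerGraph.doubledGrassmannGraph F t) ∧
      CheegerGraph.cheegerConstant (CheegerGraph.doubledGrassmannGraph F t) ≤
        CheegerGraph.lambdaOne (CheegerGraph.doubledGrassmannGraph F t) := by
  have hcard : 4 ≤ Nat.card F := by rwa [Nat.card_eq_fintype_card, hF]
  have hOK := CheegerGraph.isOK_doubledGrassmannGraph (F := F) (t := t) hcard
  exact ⟨CheegerGraph.isLeast_lambdaOne_doubledGrassmannGraph, hOK,
    CheegerGraph.cheegerConstant_le_of_isOK hOK⟩
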